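/- Let $\mathcal M=(S,A,\to,\Rightarrow,s_0)$ be a Markov automaton: $S$ is a nonempty finite set of states, $A$ a finite set of actions, $\to\ \subseteq S\times A\times \mathrm{Distr}(S)$ the probabilistic and $\Rightarrow\ \subseteq S\times\mathbb R_{>0}\times S$ the Markovian transition relation. As usual, an enabled action $\alpha$ of a state $s$ determines its distribution $\mu^s_\alpha$, the rates $\mathbf R(s,s')=\sum\{\lambda\mid (s,\lambda,s')\in\ \Rightarrow\}$ are finite, and every state has an outgoing transition. All actions are internal, so (maximal progress) a state with a probabilistic transition never takes a Markovian one. Let $PS$ be the set of states with a probabilistic transition (probabilistic states), $MS=S\setminus PS$ (Markovian states), and let $Act(s)\subseteq A$ be the set of actions enabled in $s$. Put $E(s)=\sum_{s'}\mathbf R(s,s')$; let $\mathbf P(s,\bot,s')=\mathbf R(s,s')/E(s)$ for $s\in MS$ and $\mathbf P(s,\alpha,s')=\mu^s_\alpha(s')$ for $s\in PS$, $\alpha\in Act(s)$. The sojourn time in a state is exponentially distributed with rate $E(s)$ if $s\in MS$ and is $0$ if $s\in PS$. Let $\mathcal I$ be the set of all nonempty bounded intervals of nonnegative reals (with open or closed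 ends), and for $I\in\mathcal I$, $t\ge 0$ let $I\ominus t=\{x-t\mid x\in I,\ x\ge t\}$. For $G\subseteq S$ let $\Diamond^I G$ be the set of infinite timed paths that occupy a state of $G$ at some time in $I$, where a path occupies its $i$-th state throughout the closed time interval from entering to leaving it. Let $p_{\max}(s,\Diamond^I G)=\sup_D \Pr_{s,D}(\Diamond^I G)$, where $D$ ranges over all general measurable policies, i.e. functions assigning, measurably, to each finite timed path a probability distribution over the actions enabled in its last state. Then $(s,I)\mapsto p_{\max}(s,\Diamond^I G)$ is the least fixed point (for the pointwise order) of the operator $\Omega:(S\times\mathcal I\to[0,1])\to(S\times\mathcal I\to[0,1])$ defined, with $a=\inf I$ and $b=\sup I$, for $s\in MS$ by $$\Omega(F)(s,I)=\begin{cases}\displaystyle\int_0^b E(s)e^{-E(s)t}\sum_{s'\in S}\mathbf P(s,\bot,s')F(s',I\ominus t)\,dt & s\notin G,\\[2mm] \displaystyle e^{-E(s)a}+\int_0^a E(s)e^{-E(s)t}\sum_{s'\in S}\mathbf P(s,\bot,s')F(s',I\ominus t)\,dt & s\in G,\end{cases}$$ and for $s\in PS$ by $$\Omega(F)(s,I)=\begin{cases}1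 & s\in G\text{ and }0\in I,\\ \displaystyle\max_{\alpha\in Act(s)}\sum_{s'\in S}\mathbf P(s,\alpha,s')F(s',I) & \text{otherwise.}\end{cases}$$ Moreover, for $F=p_{\max}$ the integrands are measurable. (For functions $F$ whose integrand is not measurable, the integral is the lower integral, i.e. the supremum of the integrals of the measurable functions below the integrand. $F(s',I\ominus t)$ is read as $0$ if $I\ominus t=\emptyset$, which matters for at most the one point $t=b$.) -/

import Mathlib

open MeasureTheory ProbabilityTheory Set
open scoped ENNReal NNReal

noncomputable section

/-- A Markov automaton with finite state space `S` and finite set of actions `A` (finiteness is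
imposed by the type classes of the results): a probabilistic transition relation
`prob ⊆ S × A × Distr(S)`, a Markovian transition relation `markov ⊆ S × ℝ_{>0} × S` and an initial
state.  The last three fields are the standing conventions: the total rates are finite; an action
enabled in a state determines the distribution it leads to; every state has an outgoing
transition (all paths are infinite). -/
structure MarkovAutomaton (S A : Type*) where
  init : S
  prob : S → A → PMF S → Prop
  markov : S → ℝ → S → Prop
  markov_pos : ∀ s r s', markov s r s' → 0 < r
  summable_rate : ∀ s s', Summable fun r : {r : ℝ // markov s r s'} => (r : ℝ)
  prob_unique : ∀ s α μ ν, prob s α μ → prob s α ν → μ = ν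
  no_deadlock : ∀ s, (∃ α μ, prob s α μ) ∨ ∃ r s', markov s r s'

/-- Transition labels: `bot` (written `⊥`) for Markovian transitions, and the actions. -/
inductive Label (A : Type*) where
  | bot : Label A
  | act : A → Label A

instance (A : Type*) : MeasurableSpace (Label A) := ⊤

instance (A : Type*) [Finite A] : Finite (Label A) :=
  Finite.of_surjective (fun o : Option A => o.elim Label.bot Label.act) (by
    rintro (_ | a)
    · exact ⟨none, rfl⟩
    · exact ⟨some a, rfl⟩)

instance (A : Type*) [Finite A] : Fintype (Label A) := Fintype.ofFinite _

/-- Nonempty, bounded intervals of nonnegative reals, with open or closed ends. -/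
structure TimeInterval where
  carrier : Set ℝ
  nonempty : carrier.Nonempty
  ordConnected : carrier.OrdConnected
  bddAbove : BddAbove carrier
  nonneg : ∀ x ∈ carrier, 0 ≤ x

namespace TimeInterval

/-- `I ⊖ t = {x - t | x ∈ I, x ≥ t}` as a set. -/
def shiftSet (I : TimeInterval) (t : ℝ) : Set ℝ :=
  {y | ∃ x ∈ I.carrier, t ≤ x ∧ y = x - t}

/-- `I ⊖ t` as an interval, when it is nonempty. -/
def shift (I : TimeInterval) (t : ℝ) (h : (I.shiftSet t).Nonempty) : TimeInterval where
  carrier := I.shiftSet t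
  nonempty := h
  ordConnected := by
    refine ⟨?_⟩
    rintro _ ⟨x, hx, htx, rfl⟩ _ ⟨y, hy, hty, rfl⟩ z ⟨h1, h2⟩
    refine ⟨z + t, I.ordConnected.out hx hy ⟨?_, ?_⟩, ?_, ?_⟩ <;> linarith
  bddAbove := by
    obtain ⟨M, hM⟩ := I.bddAbove
    refine ⟨M - t, ?_⟩
    rintro _ ⟨x, hx, -, rfl⟩
    have := hM hx
    linarith
  nonneg := by
    rintro _ ⟨x, -, htx, rfl⟩
    linarith

/-- `f (I ⊖ t)`, where `f` is extended by `0` to the empty set (for `0 ≤ t ≤ sup I`,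
the set `I ⊖ t` is empty at most for `t = sup I`). -/
def evalShift (f : TimeInterval → ℝ≥0∞) (I : TimeInterval) (t : ℝ) : ℝ≥0∞ :=
  open Classical in
  if h : (I.shiftSet t).Nonempty then f (I.shift t h) else 0

end TimeInterval

/-- One step of a path: the label of the transition, the sojourn time before it in the source
state, and the target state. -/
abbrev Step (S A : Type*) := Label A × ℝ≥0 × S

/-- A path `s₀ -σ₀,t₀→ s₁ -σ₁,t₁→ s₂ ⋯` is encoded as the sequence
`(⊥, 0, s₀), (σ₀, t₀, s₁), (σ₁, t₁, s₂), …` (the first two entries are dummies).  The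
distributions decorating the transitions are determined by states and labels. -/
abbrev TimedPath (S A : Type*) := ℕ → Step S A

/-- Finite paths with `n` transitions, in the same encoding. -/
abbrev FinPath (S A : Type*) (n : ℕ) := (_ : Finset.Iic n) → Step S A

/-- The last state of a finite path. -/
def FinPath.last {S A : Type*} {n : ℕ} (h : FinPath S A n) : S :=
  (h ⟨n, Finset.mem_Iic.2 le_rfl⟩).2.2

namespace TimedPath

variable {S A : Type*}

/-- The `i`-th state. -/
def state (π : TimedPath S A) (i : ℕ) : S := (π i).2.2

/-- The sojourn time in the `i`-th state. -/
def sojourn (π : TimedPath S A) (i : ℕ) : ℝ≥0 := (π (i + 1)).2.1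

/-- The time at which the `i`-th state is entered. -/
def entryTime (π : TimedPath S A) (i : ℕ) : ℝ := ∑ k ∈ Finset.range i, (π.sojourn k : ℝ)

/-- The set of states that a path occupies at time `t`; several states may be occupied at the
same instant. -/
def occupied (π : TimedPath S A) (t : ℝ) : Set S :=
  {s | ∃ i, π.state i = s ∧ π.entryTime i ≤ t ∧ t ≤ π.entryTime (i + 1)}

/-- The set `◇^I G` of the paths that occupy some state of `G` at some time in `I`. -/
def reach (G : Set S) (I : TimeInterval) : Set (TimedPath S A) :=
  {π | ∃ t ∈ I.carrier, ∃ s ∈ G, s ∈ π.occupied t}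

end TimedPath

namespace MarkovAutomaton

variable {S A : Type*} [Fintype S] [Fintype A] (M : MarkovAutomaton S A)

/-- The actions labelling the probabilistic transitions of `s`. -/
def actions (s : S) : Set A := {α | ∃ μ, M.prob s α μ}

/-- Probabilistic states.  All actions are internal, so by maximal progress the Markovian
transitions of a state with probabilistic transitions are never taken. -/
def PS : Set S := {s | (M.actions s).Nonempty}

/-- Markovian states. -/
def MS : Set S := {s | s ∉ M.PS}

/-- The total rate `R(s, s')`. -/
def rate (s s' : S) : ℝ := ∑' r : {r : ℝ // M.markov s r s'}, (r : ℝ)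

/-- The exit rate `E(s)`. -/
def exitRate (s : S) : ℝ := ∑ s', M.rate s s'

open Classical in
/-- The labels enabled in a state: `⊥` in a Markovian state, its actions in a probabilistic one. -/
def enabled (s : S) : Set (Label A) :=
  if s ∈ M.PS then Label.act '' M.actions s else {Label.bot}

open Classical in
/-- The transition probabilities `P(s, σ, s')`. -/
def P (s : S) : Label A → S → ℝ≥0∞
  | .bot, s' => if s ∈ M.MS then ENNReal.ofReal (M.rate s s' / M.exitRate s) else 0
  | .act α, s' => if h : ∃ μ, M.prob s α μ then h.choose s' else 0

open Classical in
/-- The law of the sojourn time in a state: exponential with the exit rate in a Markovian state,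
zero in a probabilistic one. -/
def sojournLaw (s : S) : Measure ℝ≥0 :=
  if s ∈ M.PS then Measure.dirac 0 else (expMeasure (M.exitRate s)).map Real.toNNReal

lemma rate_nonneg (M : MarkovAutomaton S A) (s s' : S) : 0 ≤ M.rate s s' :=
  tsum_nonneg fun r => (M.markov_pos _ _ _ r.2).le

lemma exitRate_pos {M : MarkovAutomaton S A} {s : S} (hs : s ∈ M.MS) : 0 < M.exitRate s := by
  obtain ⟨α, μ, h⟩ | ⟨r, s', h⟩ := M.no_deadlock s
  · exact absurd ⟨α, μ, h⟩ hs
  · refine Finset.sum_pos' (fun s' _ => M.rate_nonneg s s') ⟨s', Finset.mem_univ _, ?_⟩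
    exact (M.summable_rate s s').tsum_pos (fun r => (M.markov_pos _ _ _ r.2).le) ⟨r, h⟩
      (M.markov_pos _ _ _ h)

lemma sum_P (M : MarkovAutomaton S A) {s : S} {σ : Label A} (h : σ ∈ M.enabled s) :
    ∑ s', M.P s σ s' = 1 := by
  unfold enabled at h
  split_ifs at h with hs
  · obtain ⟨α, hα, rfl⟩ := h
    have hα' : ∃ μ, M.prob s α μ := hα
    simp only [P, dif_pos hα']
    rw [← tsum_fintype (L := .unconditional S)]
    exact PMF.tsum_coe _
  · obtain rfl : σ = Label.bot := h
    have hs' : s ∈ M.MS := hs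
    have hE := exitRate_pos hs'
    simp only [P, if_pos hs']
    rw [← ENNReal.ofReal_sum_of_nonneg fun s' _ => div_nonneg (M.rate_nonneg s s') hE.le,
      ← Finset.sum_div]
    change ENNReal.ofReal (M.exitRate s / M.exitRate s) = 1
    rw [div_self hE.ne', ENNReal.ofReal_one]

variable [MeasurableSpace S]

/-- General measurable policies: for each finite path, a distribution over the labels enabled in
its last state, depending measurably on the path.  It may depend on all the
states, labels and sojourn times so far, and may be randomised. -/
structure Policy where
  choice : (n : ℕ) → FinPath S A n → PMF (Label A)
  measurable_choice : ∀ n σ, Measurable fun h => choice n h σ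
  support_subset : ∀ n h, (choice n h).support ⊆ M.enabled h.last

/-- The law of the next step when the label `σ` is chosen in `s`: the sojourn time and the next
state are independent. -/
def stepLaw (s : S) (σ : Label A) : Measure (Step S A) :=
  ∑ s', M.P s σ s' • (M.sojournLaw s).map fun t => ((σ, t, s') : Step S A)

/-- The law of the next step after the finite path `h` under the policy `D`. -/
def Policy.nextLaw {M : MarkovAutomaton S A} (D : M.Policy) (n : ℕ) (h : FinPath S A n) :
    Measure (Step S A) :=
  ∑ σ, D.choice n h σ • M.stepLaw h.last σ

lemma isProbabilityMeasure_sojournLaw (M : MarkovAutomaton S A) (s : S) :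
    IsProbabilityMeasure (M.sojournLaw s) := by
  unfold sojournLaw
  split_ifs with hs
  · infer_instance
  · have hs' : s ∈ M.MS := hs
    have := isProbabilityMeasure_expMeasure (exitRate_pos hs')
    exact Measure.isProbabilityMeasure_map measurable_real_toNNReal.aemeasurable

lemma stepLaw_univ (M : MarkovAutomaton S A) {s : S} {σ : Label A} (h : σ ∈ M.enabled s) :
    M.stepLaw s σ univ = 1 := by
  have := M.isProbabilityMeasure_sojournLaw s
  have key : ∀ s', (M.sojournLaw s).map (fun t => ((σ, t, s') : Step S A)) univ = 1 := fun s' => by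
    rw [Measure.map_apply (by fun_prop) MeasurableSet.univ, preimage_univ, measure_univ]
  simp only [stepLaw, Measure.finsetSum_apply, Measure.smul_apply, key, smul_eq_mul, mul_one]
  exact M.sum_P h

variable [DiscreteMeasurableSpace S]

/-- `Policy.nextLaw` as a probability kernel. -/
def Policy.kernel {M : MarkovAutomaton S A} (D : M.Policy) (n : ℕ) :
    Kernel (FinPath S A n) (Step S A) where
  toFun := D.nextLaw n
  measurable' := by
    refine Measure.measurable_of_measurable_coe _ fun B _ => ?_
    simp only [nextLaw, Measure.finsetSum_apply, Measure.smul_apply, smul_eq_mul]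
    refine Finset.measurable_sum _ fun σ _ => (D.measurable_choice n σ).mul ?_
    have hl : Measurable fun h : FinPath S A n => h.last := by
      unfold FinPath.last; fun_prop
    exact (Measurable.of_discrete (f := fun s => M.stepLaw s σ B)).comp hl

instance {M : MarkovAutomaton S A} (D : M.Policy) (n : ℕ) : IsMarkovKernel (D.kernel n) where
  isProbabilityMeasure h := by
    refine ⟨?_⟩
    change D.nextLaw n h univ = 1
    have : ∀ σ, D.choice n h σ * M.stepLaw h.last σ univ = D.choice n h σ := fun σ => by
      by_cases hσ : D.choice n h σ = 0
      · simp [hσ]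
      · rw [M.stepLaw_univ (D.support_subset n h ((PMF.mem_support_iff _ _).2 hσ)), mul_one]
    simp only [Policy.nextLaw, Measure.finsetSum_apply, Measure.smul_apply, smul_eq_mul, this]
    rw [← tsum_fintype (L := .unconditional _)]
    exact PMF.tsum_coe _

/-- The probability measure `Pr_{s,D}` on paths. -/
def Policy.pathMeasure {M : MarkovAutomaton S A} (D : M.Policy) (s : S) : Measure (TimedPath S A) :=
  Kernel.traj (X := fun _ => Step S A) D.kernel 0 fun _ => (Label.bot, 0, s)

/-- The maximal probability `p_max(s, ◇^I G)` over all general measurable policies. -/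
def pMax (G : Set S) (s : S) (I : TimeInterval) : ℝ≥0∞ :=
  ⨆ D : M.Policy, D.pathMeasure s (TimedPath.reach G I)

open Classical in
/-- The operator `Ω`. -/
def Omega (G : Set S) (F : S → TimeInterval → ℝ≥0∞) (s : S) (I : TimeInterval) : ℝ≥0∞ :=
  if s ∈ M.MS then
    if s ∈ G then
      ENNReal.ofReal (Real.exp (-(M.exitRate s * sInf I.carrier))) +
        ∫⁻ t in Icc 0 (sInf I.carrier),
          ENNReal.ofReal (M.exitRate s * Real.exp (-(M.exitRate s * t))) *
            ∑ s', M.P s .bot s' * TimeInterval.evalShift (F s') I t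
    else
      ∫⁻ t in Icc 0 (sSup I.carrier),
        ENNReal.ofReal (M.exitRate s * Real.exp (-(M.exitRate s * t))) *
          ∑ s', M.P s .bot s' * TimeInterval.evalShift (F s') I t
  else
    if s ∈ G ∧ (0 : ℝ) ∈ I.carrier then 1
    else ⨆ α ∈ M.actions s, ∑ s', M.P s (.act α) s' * F s' I

end MarkovAutomaton

end

noncomputable section

set_option linter.unusedSectionVars false

/-! Both the least fixed point of `Omega` and `pMax` are the limit of value iteration. In `stepValue
X n s t` the set `X` of absolute times stays fixed and the clock `t` moves. A stage only looks at
times after entry, so shifting the interval amounts to advancing the clock (`stepValue_shift`).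
Hence `Omega`, which shifts, agrees with `bellman`, which moves the clock (`Omega_eq_bellman`), and
the iterates of `Omega` from `0` are the functions `stepValue` at time `0` (`Omega_stepValue`).
Monotone convergence makes their supremum a fixed point, and monotonicity of `Omega` puts it below
every other (`isLeast_iSup_stepValue`).

On the probabilistic side, fix a horizon `n`. The optimal conditional probability of a hit within
`n` stages (`potential`) is a supermartingale under every policy, and its expectation is constant
under a policy that measurably picks maximizing labels. It starts at `stepValue` and ends at the
indicator of a hit, so `stepValue` is the exact optimum for horizon `n`. A hit always occurs at a
finite stage, so continuity from below and an exchange of suprema give `pMax_eq_iSup_stepValue`; no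
policy optimal for the infinite horizon is needed. -/

theorem measurableSet_exists_mem_between {X : Set ℝ} (hX : X.OrdConnected) :
    MeasurableSet {p : ℝ × ℝ≥0 | ∃ x ∈ X, p.1 ≤ x ∧ x ≤ p.1 + p.2} := by
  obtain rfl | ⟨x₀, h₀⟩ := X.eq_empty_or_nonempty
  · simp
  -- If `[t, t + u]` meets `X` but misses `x₀`, its endpoint nearest to `x₀` lies between two points
  -- of `X`. This replaces the projection along `x` by three measurable conditions.
  have key : {p : ℝ × ℝ≥0 | ∃ x ∈ X, p.1 ≤ x ∧ x ≤ p.1 + p.2} =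
      {p | p.1 ∈ X} ∪ {p | p.1 + (p.2 : ℝ) ∈ X} ∪
        ({p | p.1 ≤ x₀} ∩ {p | x₀ ≤ p.1 + (p.2 : ℝ)}) := by
    ext ⟨t, u⟩
    have hu : (0 : ℝ) ≤ u := u.2
    simp only [mem_ofPred_eq, mem_union, mem_inter_iff]
    constructor
    · rintro ⟨x, hx, h1, h2⟩
      rcases lt_or_ge x₀ t with h | h
      · exact .inl (.inl (hX.out h₀ hx ⟨h.le, h1⟩))
      rcases lt_or_ge (t + u) x₀ with h' | h'
      · exact .inl (.inr (hX.out hx h₀ ⟨h2, h'.le⟩))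
      · exact .inr ⟨h, h'⟩
    · rintro ((h | h) | h)
      · exact ⟨t, h, le_rfl, by linarith⟩
      · exact ⟨t + u, h, by linarith, le_rfl⟩
      · exact ⟨x₀, h₀, h⟩
  rw [key]
  have hXm := hX.measurableSet
  have h2 : Measurable fun p : ℝ × ℝ≥0 => p.1 + (p.2 : ℝ) := by fun_prop
  exact ((measurable_fst hXm).union (h2 hXm)).union
    ((measurableSet_le measurable_fst measurable_const).inter
      (measurableSet_le measurable_const h2))

/-! ### Shifted intervals. -/

namespace TimeInterval

theorem mem_shiftSet {I : TimeInterval} {t y : ℝ} :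
    y ∈ I.shiftSet t ↔ 0 ≤ y ∧ t + y ∈ I.carrier := by
  constructor
  · rintro ⟨x, hx, h, rfl⟩
    exact ⟨by linarith, by simpa using hx⟩
  · rintro ⟨h, hy⟩
    exact ⟨t + y, hy, by linarith, by ring⟩

theorem shiftSet_zero (I : TimeInterval) : I.shiftSet 0 = I.carrier := by
  ext y
  simpa [mem_shiftSet] using I.nonneg y

theorem evalShift_zero (f : TimeInterval → ℝ≥0∞) (I : TimeInterval) : evalShift f I 0 = f I := by
  have h : (I.shiftSet 0).Nonempty := I.shiftSet_zero ▸ I.nonempty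
  have : I.shift 0 h = I := by
    cases I
    simpa [shift] using shiftSet_zero _
  rw [evalShift, dif_pos h, this]

theorem evalShift_mono {f g : TimeInterval → ℝ≥0∞} (h : f ≤ g) (I : TimeInterval) (t : ℝ) :
    evalShift f I t ≤ evalShift g I t := by
  unfold evalShift
  split_ifs
  · exact h _
  · exact le_rfl

theorem evalShift_le_one {f : TimeInterval → ℝ≥0∞} (h : ∀ J, f J ≤ 1) (I : TimeInterval) (t : ℝ) :
    evalShift f I t ≤ 1 := by
  unfold evalShift
  split_ifs
  · exact h _
  · exact zero_le_one

theorem evalShift_iSup {ι : Sort*} (f : ι → TimeInterval → ℝ≥0∞) (I : TimeInterval) (t : ℝ) :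
    evalShift (fun J => ⨆ i, f i J) I t = ⨆ i, evalShift (f i) I t := by
  unfold evalShift
  split_ifs <;> simp

theorem evalShift_of_sSup_lt (f : TimeInterval → ℝ≥0∞) (I : TimeInterval) {t : ℝ}
    (h : sSup I.carrier < t) : evalShift f I t = 0 := by
  refine dif_neg ?_
  rintro ⟨_, x, hx, htx, -⟩
  exact absurd (le_csSup I.bddAbove hx) (by linarith)

theorem sInf_nonneg (I : TimeInterval) : 0 ≤ sInf I.carrier :=
  le_csInf I.nonempty I.nonneg

theorem sInf_le_of_mem {I : TimeInterval} {x : ℝ} (h : x ∈ I.carrier) : sInf I.carrier ≤ x :=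
  csInf_le ⟨0, I.nonneg⟩ h

end TimeInterval

/-! ### Integrals against the sojourn law. -/

namespace MarkovAutomaton

variable {S A : Type*} [Fintype S] [Fintype A]

instance (M : MarkovAutomaton S A) (s : S) : IsProbabilityMeasure (M.sojournLaw s) := by
  -- The sojourn law does not involve the σ-algebra on `S`, so any choice serves.
  let _ : MeasurableSpace S := ⊤
  exact M.isProbabilityMeasure_sojournLaw s

theorem enabled_nonempty (M : MarkovAutomaton S A) (s : S) : (M.enabled s).Nonempty := by
  unfold enabled
  split_ifs with h
  · exact Nonempty.image _ h
  · exact singleton_nonempty _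

theorem enabled_of_mem_MS {M : MarkovAutomaton S A} {s : S} (h : s ∈ M.MS) :
    M.enabled s = {Label.bot} := if_neg h

theorem enabled_of_mem_PS {M : MarkovAutomaton S A} {s : S} (h : s ∈ M.PS) :
    M.enabled s = Label.act '' M.actions s := if_pos h

theorem sum_P_mul_le_one (M : MarkovAutomaton S A) {s : S} {σ : Label A} (h : σ ∈ M.enabled s)
    {f : S → ℝ≥0∞} (hf : ∀ s', f s' ≤ 1) : ∑ s', M.P s σ s' * f s' ≤ 1 :=
  (Finset.sum_le_sum fun s' _ => mul_le_of_le_one_right' (hf s')).trans_eq (M.sum_P h)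

theorem lintegral_sojournLaw_of_mem_PS {M : MarkovAutomaton S A} {s : S} (h : s ∈ M.PS)
    (f : ℝ≥0 → ℝ≥0∞) : ∫⁻ u, f u ∂M.sojournLaw s = f 0 := by
  rw [sojournLaw, if_pos h, lintegral_dirac]

theorem lintegral_sojournLaw_of_mem_MS {M : MarkovAutomaton S A} {s : S} (h : s ∈ M.MS)
    {f : ℝ≥0 → ℝ≥0∞} (hf : Measurable f) :
    ∫⁻ u, f u ∂M.sojournLaw s =
      ∫⁻ t in Ici (0 : ℝ), ENNReal.ofReal (M.exitRate s * Real.exp (-(M.exitRate s * t))) *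
        f t.toNNReal := by
  have hs : s ∉ M.PS := h
  have hpdf : Measurable (gammaPDF 1 (M.exitRate s)) :=
    (measurable_gammaPDFReal 1 (M.exitRate s)).ennreal_ofReal
  rw [sojournLaw, if_neg hs, lintegral_map hf measurable_real_toNNReal, expMeasure, gammaMeasure,
    lintegral_withDensity_eq_lintegral_mul _ hpdf (g := fun t => f t.toNNReal)
      (hf.comp measurable_real_toNNReal), ← lintegral_indicator measurableSet_Ici]
  refine lintegral_congr fun t => ?_
  change exponentialPDF _ t * _ = _
  rw [exponentialPDF_eq]
  by_cases ht : 0 ≤ t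
  · simp [ht]
  · simp [ht]

theorem lintegral_Icc_exitRate {M : MarkovAutomaton S A} {s : S} (h : s ∈ M.MS) {a : ℝ}
    (ha : 0 ≤ a) :
    ∫⁻ t in Icc 0 a, ENNReal.ofReal (M.exitRate s * Real.exp (-(M.exitRate s * t))) =
      ENNReal.ofReal (1 - Real.exp (-(M.exitRate s * a))) := by
  have := lintegral_exponentialPDF_eq_antiDeriv (exitRate_pos h) a
  rw [lintegral_Iic_eq_lintegral_Iio_add_Icc _ ha, lintegral_exponentialPDF_of_nonpos le_rfl,
    zero_add, if_pos ha] at this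
  rw [← this]
  exact setLIntegral_congr_fun measurableSet_Icc fun t ht =>
    (exponentialPDF_of_nonneg ht.1).symm

theorem lintegral_Ioi_exitRate {M : MarkovAutomaton S A} {s : S} (h : s ∈ M.MS) {a : ℝ}
    (ha : 0 ≤ a) :
    ∫⁻ t in Ioi a, ENNReal.ofReal (M.exitRate s * Real.exp (-(M.exitRate s * t))) =
      ENNReal.ofReal (Real.exp (-(M.exitRate s * a))) := by
  have h1 : ∫⁻ t in Ici 0, ENNReal.ofReal (M.exitRate s * Real.exp (-(M.exitRate s * t))) = 1 := by
    have := lintegral_sojournLaw_of_mem_MS h (f := fun _ => 1) measurable_const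
    simpa using this.symm
  have hE := exitRate_pos h
  have he : Real.exp (-(M.exitRate s * a)) ≤ 1 := by
    rw [Real.exp_le_one_iff]
    nlinarith
  rw [← Icc_union_Ioi_eq_Ici ha, lintegral_union measurableSet_Ioi
    (disjoint_left.2 fun x hx hx' => not_lt.2 hx.2 hx'), lintegral_Icc_exitRate h ha] at h1
  refine (ENNReal.add_right_inj (ENNReal.ofReal_ne_top (r := 1 - Real.exp (-(M.exitRate s * a))))).1 ?_
  rw [h1, ← ENNReal.ofReal_add (by linarith) (Real.exp_pos _).le]
  simp

/-! ### Bound and monotonicity of `Omega`. -/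

variable (M : MarkovAutomaton S A) (G : Set S)

/-- The density has mass `1 - exp (-E a)` on `[0, a]`, exactly what the term `exp (-E a)` leaves
over when `s ∈ G`. -/
theorem Omega_le_one {F : S → TimeInterval → ℝ≥0∞} (hF : ∀ s I, F s I ≤ 1) (s : S)
    (I : TimeInterval) : M.Omega G F s I ≤ 1 := by
  have key : s ∈ M.MS → ∀ a : ℝ, 0 ≤ a → ∫⁻ t in Icc 0 a,
      ENNReal.ofReal (M.exitRate s * Real.exp (-(M.exitRate s * t))) *
        ∑ s', M.P s .bot s' * TimeInterval.evalShift (F s') I t ≤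
      ENNReal.ofReal (1 - Real.exp (-(M.exitRate s * a))) := fun hs a ha => by
    rw [← lintegral_Icc_exitRate hs ha]
    refine lintegral_mono fun t => mul_le_of_le_one_right' (M.sum_P_mul_le_one ?_ fun s' =>
      TimeInterval.evalShift_le_one (hF s') I t)
    rw [enabled_of_mem_MS hs]
    rfl
  have hI := I.sInf_nonneg
  unfold Omega
  split_ifs with hs hG hG
  · refine (add_le_add_right (key hs _ hI) _).trans ?_
    have he : Real.exp (-(M.exitRate s * sInf I.carrier)) ≤ 1 := by
      rw [Real.exp_le_one_iff]
      nlinarith [exitRate_pos hs]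
    rw [← ENNReal.ofReal_add (Real.exp_pos _).le (by linarith)]
    simp
  · obtain ⟨x, hx⟩ := I.nonempty
    refine (key hs _ ((I.nonneg x hx).trans (le_csSup I.bddAbove hx))).trans ?_
    rw [ENNReal.ofReal_le_one]
    linarith [Real.exp_pos (-(M.exitRate s * sSup I.carrier))]
  · exact le_rfl
  · refine iSup₂_le fun α hα => M.sum_P_mul_le_one ?_ fun s' => hF s' I
    rw [enabled_of_mem_PS (not_not.1 hs)]
    exact mem_image_of_mem _ hα

/-- The lower integral is monotone on all functions, so this applies to fixed points with
non-measurable integrands. -/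
theorem Omega_mono {F F' : S → TimeInterval → ℝ≥0∞} (h : F ≤ F') :
    M.Omega G F ≤ M.Omega G F' := by
  intro s I
  have hs (s' t) : TimeInterval.evalShift (F s') I t ≤ TimeInterval.evalShift (F' s') I t :=
    TimeInterval.evalShift_mono (h s') I t
  have h' (s') : F s' I ≤ F' s' I := h s' I
  unfold Omega
  split_ifs
  · gcongr; apply hs
  · gcongr; apply hs
  · exact le_rfl
  · gcongr; apply h'

/-! ### Value iteration and the least fixed point. -/

open Classical in
/-- The one-stage expectation of the optimal-value recursion: the label `σ` is chosen in `s`,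
entered at time `t`; the reward is `1` if `s ∈ G` is occupied at a time of `X`, and `f` at the next
state and its entry time otherwise. -/
def stageValue (X : Set ℝ) (f : S → ℝ → ℝ≥0∞) (s : S) (t : ℝ) (σ : Label A) : ℝ≥0∞ :=
  ∫⁻ u : ℝ≥0, (if s ∈ G ∧ ∃ x ∈ X, t ≤ x ∧ x ≤ t + u then 1
    else ∑ s', M.P s σ s' * f s' (t + u)) ∂M.sojournLaw s

/-- The Bellman operator on functions of a state and its entry time. -/
def bellman (X : Set ℝ) (f : S → ℝ → ℝ≥0∞) (s : S) (t : ℝ) : ℝ≥0∞ :=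
  ⨆ σ ∈ M.enabled s, M.stageValue G X f s t σ

/-- The optimal probability of occupying a state of `G` at a time of `X` within `n` stages. -/
def stepValue (X : Set ℝ) : ℕ → S → ℝ → ℝ≥0∞
  | 0 => 0
  | n + 1 => M.bellman G X (stepValue X n)

variable {M G}

open Classical in
theorem measurable_stage_integrand {X : Set ℝ} (hX : X.OrdConnected) {f : S → ℝ → ℝ≥0∞}
    (hf : ∀ s, Measurable (f s)) (s : S) (σ : Label A) :
    Measurable fun p : ℝ × ℝ≥0 => if s ∈ G ∧ ∃ x ∈ X, p.1 ≤ x ∧ x ≤ p.1 + p.2 then 1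
      else ∑ s', M.P s σ s' * f s' (p.1 + p.2) := by
  refine Measurable.ite ((MeasurableSet.const _).inter (measurableSet_exists_mem_between hX))
    measurable_const (Finset.measurable_sum _ fun s' _ => ?_)
  exact ((hf s').comp (by fun_prop)).const_mul _

theorem measurable_stageValue {X : Set ℝ} (hX : X.OrdConnected) {f : S → ℝ → ℝ≥0∞}
    (hf : ∀ s, Measurable (f s)) (s : S) (σ : Label A) :
    Measurable fun t => M.stageValue G X f s t σ :=
  (measurable_stage_integrand hX hf s σ).lintegral_prod_right'

theorem measurable_bellman {X : Set ℝ} (hX : X.OrdConnected) {f : S → ℝ → ℝ≥0∞}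
    (hf : ∀ s, Measurable (f s)) (s : S) : Measurable (M.bellman G X f s) :=
  Measurable.biSup _ (to_countable _) fun σ _ => measurable_stageValue hX hf s σ

theorem measurable_stepValue {X : Set ℝ} (hX : X.OrdConnected) (n : ℕ) (s : S) :
    Measurable (M.stepValue G X n s) := by
  induction n generalizing s with
  | zero => exact measurable_const
  | succ n ih => exact measurable_bellman hX ih s

/-- A stage entered at `r ≥ 0` never inspects negative times, so cutting the shifted set off at `0`
loses nothing. -/
theorem stepValue_shift {X Y : Set ℝ} {t : ℝ} (h : ∀ y, y ∈ Y ↔ 0 ≤ y ∧ t + y ∈ X) (n : ℕ) (s : S)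
    {r : ℝ} (hr : 0 ≤ r) : M.stepValue G Y n s r = M.stepValue G X n s (t + r) := by
  induction n generalizing s r with
  | zero => rfl
  | succ n ih =>
    refine iSup_congr fun σ => iSup_congr fun _ => lintegral_congr fun u => ?_
    have hc : (∃ x ∈ Y, r ≤ x ∧ x ≤ r + u) ↔ ∃ x ∈ X, t + r ≤ x ∧ x ≤ t + r + u := by
      constructor
      · rintro ⟨x, hx, h1, h2⟩
        exact ⟨t + x, ((h x).1 hx).2, by linarith, by linarith⟩
      · rintro ⟨x, hx, h1, h2⟩
        exact ⟨x - t, (h _).2 ⟨by linarith, by simpa using hx⟩, by linarith, by linarith⟩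
    have hsum : ∑ s', M.P s σ s' * M.stepValue G Y n s' (r + u) =
        ∑ s', M.P s σ s' * M.stepValue G X n s' (t + r + u) :=
      Finset.sum_congr rfl fun s' _ => by rw [ih _ (add_nonneg hr u.coe_nonneg), add_assoc]
    rw [hsum]
    congr 1
    rw [hc]

/-- Matches the default value `0` of `evalShift` on an empty shift. -/
theorem stepValue_empty (n : ℕ) (s : S) (t : ℝ) : M.stepValue G ∅ n s t = 0 := by
  induction n generalizing s t with
  | zero => rfl
  | succ n ih => simp [stepValue, bellman, stageValue, ih]

theorem evalShift_stepValue (n : ℕ) (s : S) (I : TimeInterval) (t : ℝ) :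
    TimeInterval.evalShift (fun J => M.stepValue G J.carrier n s 0) I t =
      M.stepValue G I.carrier n s t := by
  have key : M.stepValue G (I.shiftSet t) n s 0 = M.stepValue G I.carrier n s t := by
    rw [stepValue_shift (fun y => TimeInterval.mem_shiftSet) n s le_rfl, add_zero]
  unfold TimeInterval.evalShift
  split_ifs with h
  · exact key
  · rw [← key, not_nonempty_iff_eq_empty.1 h, stepValue_empty]

theorem Omega_eq_bellman {F : S → TimeInterval → ℝ≥0∞} (I : TimeInterval)
    (hF : ∀ s, Measurable fun t => TimeInterval.evalShift (F s) I t) (s : S) :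
    M.Omega G F s I = M.bellman G I.carrier (fun s' t => TimeInterval.evalShift (F s') I t) s 0 := by
  by_cases hs : s ∈ M.MS
  · have hm := (measurable_stage_integrand (M := M) (G := G) I.ordConnected hF s .bot).comp
      (measurable_prodMk_left (x := (0 : ℝ)))
    simp only [Function.comp_def, zero_add] at hm
    simp only [Omega, if_pos hs, bellman, enabled_of_mem_MS hs, mem_singleton_iff, iSup_iSup_eq_left,
      stageValue, zero_add]
    rw [lintegral_sojournLaw_of_mem_MS hs hm]
    have hsum : ∀ t : ℝ, sSup I.carrier < t →
        ∑ s', M.P s .bot s' * TimeInterval.evalShift (F s') I t = 0 := fun t ht => by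
      simp [TimeInterval.evalShift_of_sSup_lt _ I ht]
    have hdis (a : ℝ) : Disjoint (Icc 0 a) (Ioi a) :=
      disjoint_left.2 fun x hx hx' => not_lt.2 hx.2 hx'
    split_ifs with hG
    · rw [← Icc_union_Ioi_eq_Ici I.sInf_nonneg, lintegral_union measurableSet_Ioi (hdis _), add_comm,
        ← lintegral_Ioi_exitRate hs I.sInf_nonneg]
      congr 1
      -- Leaving before `sInf I` gives no hit. At `t = sInf I` this depends on whether the end is
      -- closed, but one point is null.
      · refine setLIntegral_congr_fun_ae measurableSet_Icc ?_
        filter_upwards [measure_eq_zero_iff_ae_notMem.1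
          (measure_singleton (μ := volume) (sInf I.carrier))] with t ht hta
        have hlt : t < sInf I.carrier := lt_of_le_of_ne hta.2 ht
        rw [if_neg, Real.coe_toNNReal _ hta.1]
        rintro ⟨-, x, hx, -, hxt⟩
        rw [Real.coe_toNNReal _ hta.1] at hxt
        linarith [TimeInterval.sInf_le_of_mem hx]
      -- Leaving later than `sInf I` means that some point of `I` was passed in `s`, so the reward
      -- is `1`.
      · refine setLIntegral_congr_fun measurableSet_Ioi fun t (ht : _ < t) => ?_
        have ht0 : 0 ≤ t := I.sInf_nonneg.trans ht.le
        obtain ⟨x, hx, hxt⟩ := exists_lt_of_csInf_lt I.nonempty ht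
        rw [if_pos ⟨hG, x, hx, I.nonneg x hx, by
          rw [Real.coe_toNNReal _ ht0, zero_add]; exact hxt.le⟩, mul_one]
    · obtain ⟨x, hx⟩ := I.nonempty
      have hb : 0 ≤ sSup I.carrier := (I.nonneg x hx).trans (le_csSup I.bddAbove hx)
      simp only [hG, false_and, if_false]
      rw [← Icc_union_Ioi_eq_Ici hb, lintegral_union measurableSet_Ioi (hdis _)]
      -- Past `sSup I` the shifted interval is empty and nothing more can be gained.
      have h0 : ∫⁻ t in Ioi (sSup I.carrier),
          ENNReal.ofReal (M.exitRate s * Real.exp (-(M.exitRate s * t))) *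
            ∑ s', M.P s .bot s' * TimeInterval.evalShift (F s') I t.toNNReal = 0 := by
        rw [setLIntegral_congr_fun (g := 0) measurableSet_Ioi, Pi.zero_def, lintegral_zero]
        intro t (ht : _ < t)
        simp only [Pi.zero_apply]
        rw [Real.coe_toNNReal _ (hb.trans ht.le), hsum t ht, mul_zero]
      rw [h0, add_zero]
      refine setLIntegral_congr_fun measurableSet_Icc fun t ht => ?_
      rw [Real.coe_toNNReal _ ht.1]
  · have hs' : s ∈ M.PS := not_not.1 hs
    have hc : (s ∈ G ∧ ∃ x ∈ I.carrier, (0 : ℝ) ≤ x ∧ x ≤ 0 + ((0 : ℝ≥0) : ℝ)) ↔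
        s ∈ G ∧ (0 : ℝ) ∈ I.carrier := by
      rw [NNReal.coe_zero, add_zero]
      exact and_congr_right fun _ =>
        ⟨fun ⟨x, hx, h1, h2⟩ => le_antisymm h2 h1 ▸ hx, fun h => ⟨0, h, le_rfl, le_rfl⟩⟩
    simp only [Omega, if_neg hs, bellman, enabled_of_mem_PS hs', iSup_image, stageValue,
      lintegral_sojournLaw_of_mem_PS hs']
    by_cases hG : s ∈ G ∧ (0 : ℝ) ∈ I.carrier
    · obtain ⟨α, hα⟩ := hs'
      simp only [if_pos hG, if_pos (hc.2 hG)]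
      exact le_antisymm (le_iSup₂_of_le α hα le_rfl) (iSup₂_le fun _ _ => le_rfl)
    · rw [if_neg hG]
      refine iSup_congr fun α => iSup_congr fun _ => ?_
      rw [if_neg (mt hc.1 hG)]
      simp only [NNReal.coe_zero, add_zero, TimeInterval.evalShift_zero]

theorem Omega_stepValue (n : ℕ) :
    M.Omega G (fun s I => M.stepValue G I.carrier n s 0) =
      fun s I => M.stepValue G I.carrier (n + 1) s 0 := by
  funext s I
  rw [Omega_eq_bellman I fun s => ?_]
  · simp only [evalShift_stepValue]
    rfl
  · simp only [evalShift_stepValue]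
    exact measurable_stepValue I.ordConnected n s

theorem monotone_stepValue (I : TimeInterval) (s : S) :
    Monotone fun n => M.stepValue G I.carrier n s 0 := by
  have : Monotone fun n (s : S) (I : TimeInterval) => M.stepValue G I.carrier n s 0 := by
    refine monotone_nat_of_le_succ fun n => ?_
    induction n with
    | zero => exact fun _ _ => zero_le
    | succ n ih =>
      rw [← Omega_stepValue, ← Omega_stepValue]
      exact M.Omega_mono G ih
  exact fun m n h => this h s I

/-- The supremum over labels commutes with that over `n`; the integral and the finite sum commute
with it by monotonicity in `n`. -/
theorem bellman_iSup {X : Set ℝ} (hX : X.OrdConnected) {f : ℕ → S → ℝ → ℝ≥0∞}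
    (hf : ∀ n s, Measurable (f n s)) (hmono : Monotone f) (s : S) (t : ℝ) :
    M.bellman G X (fun s t => ⨆ n, f n s t) s t = ⨆ n, M.bellman G X (f n) s t := by
  simp only [bellman]
  rw [iSup_comm]
  refine iSup_congr fun σ => ?_
  rw [iSup_comm]
  refine iSup_congr fun _ => ?_
  simp only [stageValue]
  rw [← lintegral_iSup]
  · refine lintegral_congr fun u => ?_
    split_ifs
    · simp
    · simp only [ENNReal.mul_iSup]
      refine ENNReal.finsetSum_iSup_of_monotone fun s' m n h => ?_
      gcongr
      exact hmono h s' _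
  · exact fun n => (measurable_stage_integrand hX (hf n) s σ).comp measurable_prodMk_left
  · intro m n h u
    simp only
    split_ifs
    · exact le_rfl
    · gcongr
      apply hmono h

theorem measurable_evalShift_iSup_stepValue (s : S) (I : TimeInterval) :
    Measurable fun t =>
      TimeInterval.evalShift (fun J => ⨆ n, M.stepValue G J.carrier n s 0) I t := by
  simp only [TimeInterval.evalShift_iSup, evalShift_stepValue]
  exact .iSup fun n => measurable_stepValue I.ordConnected n s

theorem isLeast_iSup_stepValue :
    IsLeast {F : S → TimeInterval → ℝ≥0∞ | (∀ s I, F s I ≤ 1) ∧ M.Omega G F = F}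
      fun s I => ⨆ n, M.stepValue G I.carrier n s 0 := by
  refine ⟨⟨fun s I => iSup_le fun n => ?_, ?_⟩, ?_⟩
  · induction n generalizing s I with
    | zero => exact zero_le_one
    | succ n ih =>
      have := M.Omega_le_one G ih s I
      rwa [Omega_stepValue] at this
  · funext s I
    rw [Omega_eq_bellman I fun s => measurable_evalShift_iSup_stepValue s I]
    simp only [TimeInterval.evalShift_iSup, evalShift_stepValue]
    rw [bellman_iSup I.ordConnected (fun n s => measurable_stepValue I.ordConnected n s)]
    · exact (monotone_stepValue I s).iSup_nat_add 1
    · intro m n h s t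
      change M.stepValue G _ m s t ≤ M.stepValue G _ n s t
      rw [← evalShift_stepValue, ← evalShift_stepValue]
      exact TimeInterval.evalShift_mono (fun J => monotone_stepValue J s h) I t
  · rintro F ⟨-, hF⟩ s I
    refine iSup_le fun n => ?_
    induction n generalizing s I with
    | zero => exact zero_le
    | succ n ih =>
      have := M.Omega_mono G ih s I
      rwa [Omega_stepValue, hF] at this

end MarkovAutomaton

/-! ### Measurable selection. -/

/-- A finite family of measurable functions has a measurable pointwise maximizer. -/
theorem exists_measurable_argmax {α ι : Type*} [MeasurableSpace α] [MeasurableSpace ι]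
    {f : ι → α → ℝ≥0∞} (hf : ∀ i, Measurable (f i)) {E : Set ι} (hE : E.Finite)
    (hne : E.Nonempty) :
    ∃ g : α → ι, Measurable g ∧ ∀ x, g x ∈ E ∧ f (g x) x = ⨆ i ∈ E, f i x := by
  -- Measurability of the running maximum is carried through the induction: it makes the set where
  -- the new index wins measurable.
  suffices ∃ g : α → ι, Measurable g ∧ (Measurable fun x => f (g x) x) ∧
      ∀ x, g x ∈ E ∧ f (g x) x = ⨆ i ∈ E, f i x from
    this.imp fun g h => ⟨h.1, h.2.2⟩
  classical
  lift E to Finset ι using hE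
  rw [Finset.coe_nonempty] at hne
  induction hne using Finset.Nonempty.cons_induction with
  | singleton a => exact ⟨fun _ => a, measurable_const, hf a, fun x => by simp⟩
  | cons a s _ _ ih =>
    obtain ⟨g, hg, hfg, h⟩ := ih
    have hms : MeasurableSet {x | f (g x) x ≤ f a x} := measurableSet_le hfg (hf a)
    refine ⟨fun x => if f (g x) x ≤ f a x then a else g x, .ite hms measurable_const hg, ?_,
      fun x => ?_⟩
    · convert Measurable.ite hms (hf a) hfg using 2 with x
      exact apply_ite (f · x) _ _ _
    · rw [Finset.coe_cons, iSup_insert, ← (h x).2]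
      beta_reduce
      split_ifs with hx
      · exact ⟨mem_insert _ _, (sup_eq_left.2 hx).symm⟩
      · exact ⟨mem_insert_of_mem _ (h x).1, (sup_eq_right.2 (not_le.1 hx).le).symm⟩

instance (A : Type*) : DiscreteMeasurableSpace (Label A) := ⟨fun _ => trivial⟩

/-! ### Finite prefixes and hits within finitely many stages. -/

namespace FinPath

variable {S A : Type*}

/-- The extension of a finite path that repeats its last step. -/
def extend {n : ℕ} (h : FinPath S A n) : TimedPath S A :=
  fun j => h ⟨min j n, Finset.mem_Iic.2 (min_le_right _ _)⟩

theorem extend_state {n : ℕ} (h : FinPath S A n) : h.extend.state n = h.last := by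
  simp [TimedPath.state, extend, last]

theorem measurable_extend [MeasurableSpace S] {n : ℕ} :
    Measurable (extend : FinPath S A n → TimedPath S A) :=
  measurable_pi_lambda _ fun _ => measurable_pi_apply _

end FinPath

namespace TimedPath

variable {S A : Type*}

theorem extend_frestrictLe {n j : ℕ} (hj : j ≤ n) (π : TimedPath S A) :
    FinPath.extend (Preorder.frestrictLe n π : FinPath S A n) j = π j := by
  simp [FinPath.extend, Preorder.frestrictLe, hj]

/-- The path occupies one of its first `n` states while this state is in `G` and the time in `X`. -/
def HitsWithin (G : Set S) (X : Set ℝ) (n : ℕ) (π : TimedPath S A) : Prop :=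
  ∃ i < n, π.state i ∈ G ∧ ∃ x ∈ X, π.entryTime i ≤ x ∧ x ≤ π.entryTime i + π.sojourn i

theorem entryTime_succ (π : TimedPath S A) (i : ℕ) :
    π.entryTime (i + 1) = π.entryTime i + π.sojourn i :=
  Finset.sum_range_succ _ _

theorem reach_eq_iUnion (G : Set S) (I : TimeInterval) :
    reach (A := A) G I = ⋃ n, {π | π.HitsWithin G I.carrier n} := by
  ext π
  simp only [reach, occupied, mem_iUnion]
  constructor
  · rintro ⟨t, ht, s, hs, i, rfl, h1, h2⟩
    exact ⟨i + 1, i, i.lt_succ_self, hs, t, ht, h1, π.entryTime_succ i ▸ h2⟩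
  · rintro ⟨n, i, -, hs, t, ht, h1, h2⟩
    exact ⟨t, ht, _, hs, i, rfl, h1, (π.entryTime_succ i).symm ▸ h2⟩

theorem hitsWithin_succ {G : Set S} {X : Set ℝ} {n : ℕ} {π : TimedPath S A} :
    π.HitsWithin G X (n + 1) ↔ π.HitsWithin G X n ∨
      π.state n ∈ G ∧ ∃ x ∈ X, π.entryTime n ≤ x ∧ x ≤ π.entryTime n + π.sojourn n := by
  constructor
  · rintro ⟨i, hi, h⟩
    rcases Nat.lt_succ_iff_lt_or_eq.1 hi with hi | rfl
    · exact .inl ⟨i, hi, h⟩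
    · exact .inr h
  · rintro (⟨i, hi, h⟩ | h)
    · exact ⟨i, hi.trans n.lt_succ_self, h⟩
    · exact ⟨n, n.lt_succ_self, h⟩

theorem entryTime_congr {n : ℕ} {π π' : TimedPath S A} (h : ∀ j ≤ n, π j = π' j) :
    π.entryTime n = π'.entryTime n :=
  Finset.sum_congr rfl fun i hi => by
    simp only [sojourn, h (i + 1) (Finset.mem_range.1 hi)]

/-- Step `n` is included because the sojourn time in state `n - 1` is recorded there. -/
theorem hitsWithin_congr {G : Set S} {X : Set ℝ} {n : ℕ} {π π' : TimedPath S A}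
    (h : ∀ j ≤ n, π j = π' j) : π.HitsWithin G X n ↔ π'.HitsWithin G X n := by
  refine exists_congr fun i => and_congr_right fun hi => ?_
  rw [entryTime_congr (π := π) fun j hj => h j (hj.trans hi.le)]
  simp only [state, sojourn, h i hi.le, h (i + 1) hi]

variable [MeasurableSpace S]

theorem measurable_sojourn (i : ℕ) : Measurable fun π : TimedPath S A => π.sojourn i :=
  (measurable_pi_apply (i + 1)).snd.fst

theorem measurable_entryTime (i : ℕ) : Measurable fun π : TimedPath S A => π.entryTime i :=
  Finset.measurable_sum _ fun k _ => (measurable_sojourn k).coe_nnreal_real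

theorem measurable_state (i : ℕ) : Measurable fun π : TimedPath S A => π.state i :=
  (measurable_pi_apply i).snd.snd

theorem measurableSet_hitsWithin [DiscreteMeasurableSpace S] (G : Set S) {X : Set ℝ}
    (hX : X.OrdConnected) (n : ℕ) :
    MeasurableSet {π : TimedPath S A | π.HitsWithin G X n} := by
  have : {π : TimedPath S A | π.HitsWithin G X n} = ⋃ i, ⋃ (_ : i < n),
      ((fun π => π.state i) ⁻¹' G ∩ (fun π => (π.entryTime i, π.sojourn i)) ⁻¹'
        {p : ℝ × ℝ≥0 | ∃ x ∈ X, p.1 ≤ x ∧ x ≤ p.1 + p.2}) := by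
    ext π
    simp [HitsWithin, and_left_comm]
  rw [this]
  exact .iUnion fun i => .iUnion fun _ => (measurable_state i (.of_discrete)).inter
    (((measurable_entryTime i).prodMk (measurable_sojourn i))
      (measurableSet_exists_mem_between hX))

end TimedPath

/-! ### The potential along the path measure. -/

namespace MarkovAutomaton

variable {S A : Type*} [Fintype S] [Fintype A] [MeasurableSpace S] [DiscreteMeasurableSpace S]
  {M : MarkovAutomaton S A} {G : Set S}

theorem measurable_uncurry_of_finite {β : Type*} [MeasurableSpace β] {f : S → ℝ → β}
    (hf : ∀ s, Measurable (f s)) : Measurable fun p : S × ℝ => f p.1 p.2 :=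
  measurable_from_prod_countable_right hf

theorem lintegral_stepLaw (s : S) (σ : Label A) {f : Step S A → ℝ≥0∞} (hf : Measurable f) :
    ∫⁻ y, f y ∂M.stepLaw s σ = ∫⁻ u, ∑ s', M.P s σ s' * f (σ, u, s') ∂M.sojournLaw s := by
  have h (s' : S) : Measurable fun u : ℝ≥0 => ((σ, u, s') : Step S A) := by fun_prop
  rw [stepLaw, lintegral_finsetSum_measure,
    lintegral_finsetSum (f := fun s' u => M.P s σ s' * f (σ, u, s')) _ fun s' _ =>
      (hf.comp (h s')).const_mul _]
  refine Finset.sum_congr rfl fun s' _ => ?_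
  rw [lintegral_smul_measure, lintegral_map hf (h s'),
    lintegral_const_mul (f := fun u => f (σ, u, s')) _ (hf.comp (h s')),
    smul_eq_mul]

theorem lintegral_nextLaw (D : M.Policy) (n : ℕ) (h : FinPath S A n) (f : Step S A → ℝ≥0∞) :
    ∫⁻ y, f y ∂D.kernel n h = ∑ σ, D.choice n h σ * ∫⁻ y, f y ∂M.stepLaw h.last σ := by
  change ∫⁻ y, f y ∂D.nextLaw n h = _
  simp [Policy.nextLaw, lintegral_finsetSum_measure, lintegral_smul_measure]

/-- The law of the prefix together with the next step is the composition-product of the prefix law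
with the kernel; this is how conditioning on the prefix enters. -/
theorem lintegral_pathMeasure_pair (D : M.Policy) (s : S) (n : ℕ)
    {f : FinPath S A n → Step S A → ℝ≥0∞} (hf : Measurable f.uncurry) :
    ∫⁻ π, f (Preorder.frestrictLe n π) (π (n + 1)) ∂D.pathMeasure s =
      ∫⁻ π, ∫⁻ y, f (Preorder.frestrictLe n π) y ∂D.kernel n (Preorder.frestrictLe n π)
        ∂D.pathMeasure s := by
  let x₀ : (i : Finset.Iic 0) → (fun _ : ℕ => Step S A) i := fun _ => (Label.bot, 0, s)
  have h1 := Kernel.partialTraj_compProd_eq_map_traj (X := fun _ => Step S A) (κ := D.kernel) (Nat.zero_le n)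
    (x₀ := x₀)
  have h2 := Kernel.traj_map_frestrictLe_apply (X := fun _ => Step S A) (κ := D.kernel) 0 n x₀
  have h3 : Measurable fun h => ∫⁻ y, f h y ∂D.kernel n h := hf.lintegral_kernel_prod_right
  rw [Policy.pathMeasure, ← lintegral_map h3 (Preorder.measurable_frestrictLe n), h2]
  have h4 (μ : Measure (FinPath S A n)) [SFinite μ] : ∫⁻ p, f.uncurry p ∂(μ ⊗ₘ D.kernel n) =
      ∫⁻ h, ∫⁻ y, f h y ∂D.kernel n h ∂μ := Measure.lintegral_compProd hf
  rw [← h4, h1, lintegral_map hf (by fun_prop)]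
  rfl

open Classical in
/-- The optimal conditional probability, given the first `k` steps, of occupying a state of `G` at
a time of `X` within `k + m` stages. -/
def potential (M : MarkovAutomaton S A) (G : Set S) (X : Set ℝ) (k m : ℕ) (π : TimedPath S A) :
    ℝ≥0∞ :=
  if π.HitsWithin G X k then 1 else M.stepValue G X m (π.state k) (π.entryTime k)

open Classical in
/-- `potential` after one more step `y`. -/
def nextPotential (M : MarkovAutomaton S A) (G : Set S) (X : Set ℝ) (k m : ℕ) (h : FinPath S A k)
    (y : Step S A) : ℝ≥0∞ :=
  if h.extend.HitsWithin G X k ∨ h.last ∈ G ∧ ∃ x ∈ X, h.extend.entryTime k ≤ x ∧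
      x ≤ h.extend.entryTime k + y.2.1 then 1
  else M.stepValue G X m y.2.2 (h.extend.entryTime k + y.2.1)

theorem measurable_last {k : ℕ} : Measurable (FinPath.last : FinPath S A k → S) :=
  (measurable_pi_apply _).snd.snd

theorem measurable_nextPotential {X : Set ℝ} (hX : X.OrdConnected) (k m : ℕ) :
    Measurable (M.nextPotential G X k m).uncurry := by
  have hT : Measurable fun p : FinPath S A k × Step S A => p.1.extend.entryTime k :=
    (TimedPath.measurable_entryTime k).comp (FinPath.measurable_extend.comp measurable_fst)
  have hu : Measurable fun p : FinPath S A k × Step S A => p.2.2.1 := by fun_prop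
  refine Measurable.ite ?_ measurable_const ?_
  · refine (FinPath.measurable_extend.comp measurable_fst
      (TimedPath.measurableSet_hitsWithin G hX k)).union (((measurable_last.comp measurable_fst)
        (.of_discrete (s := G))).inter ((hT.prodMk hu) (measurableSet_exists_mem_between hX)))
  · exact (measurable_uncurry_of_finite (measurable_stepValue hX m)).comp
      (Measurable.prodMk (by fun_prop) (hT.add hu.coe_nnreal_real))

theorem potential_succ {X : Set ℝ} (k m : ℕ) (π : TimedPath S A) :
    M.potential G X (k + 1) m π =
      M.nextPotential G X k m (Preorder.frestrictLe k π) (π (k + 1)) := by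
  have h (j) (hj : j ≤ k) := TimedPath.extend_frestrictLe hj π
  have hl : FinPath.last (Preorder.frestrictLe k π : FinPath S A k) = π.state k := rfl
  unfold potential nextPotential
  rw [TimedPath.hitsWithin_succ, TimedPath.hitsWithin_congr h, TimedPath.entryTime_congr h, hl,
    TimedPath.entryTime_succ]
  congr

theorem potential_frestrictLe {X : Set ℝ} (k m : ℕ) (π : TimedPath S A) :
    M.potential G X k m (FinPath.extend (Preorder.frestrictLe k π : FinPath S A k)) =
      M.potential G X k m π := by
  have h (j) (hj : j ≤ k) := TimedPath.extend_frestrictLe hj π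
  unfold potential
  rw [TimedPath.hitsWithin_congr h, TimedPath.entryTime_congr h, FinPath.extend_state]
  rfl

theorem sum_choice {D : M.Policy} {n : ℕ} (h : FinPath S A n) : ∑ σ, D.choice n h σ = 1 := by
  rw [← tsum_fintype (L := .unconditional _)]
  exact PMF.tsum_coe _

theorem lintegral_stepLaw_nextPotential {X : Set ℝ} (hX : X.OrdConnected) (k m : ℕ)
    {h : FinPath S A k} {σ : Label A} (hσ : σ ∈ M.enabled h.last) :
    ∫⁻ y, M.nextPotential G X k m h y ∂M.stepLaw h.last σ =
      open Classical in if h.extend.HitsWithin G X k then 1 else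
        M.stageValue G X (M.stepValue G X m) h.last (h.extend.entryTime k) σ := by
  rw [lintegral_stepLaw (f := M.nextPotential G X k m h) _ _ ((measurable_nextPotential hX k m).comp measurable_prodMk_left)]
  split_ifs with hh
  · simp [nextPotential, hh, M.sum_P hσ]
  · refine lintegral_congr fun u => ?_
    by_cases hG : h.last ∈ G ∧ ∃ x ∈ X, h.extend.entryTime k ≤ x ∧ x ≤ h.extend.entryTime k + u
    · simp [nextPotential, hG, M.sum_P hσ]
    · simp [nextPotential, hG, hh]

/-- Supermartingale step: a randomised choice averages `stageValue` over enabled labels, and an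
average is at most the supremum. -/
theorem lintegral_nextPotential_le (D : M.Policy) {X : Set ℝ} (hX : X.OrdConnected) (k m : ℕ)
    (h : FinPath S A k) :
    ∫⁻ y, M.nextPotential G X k m h y ∂D.kernel k h ≤ M.potential G X k (m + 1) h.extend := by
  rw [lintegral_nextLaw]
  calc ∑ σ, D.choice k h σ * ∫⁻ y, M.nextPotential G X k m h y ∂M.stepLaw h.last σ
      ≤ ∑ σ, D.choice k h σ * M.potential G X k (m + 1) h.extend := by
        refine Finset.sum_le_sum fun σ _ => ?_
        -- Labels of probability zero need not be enabled, so the bound by the supremum is used only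
        -- for the others.
        by_cases hσ : D.choice k h σ = 0
        · simp [hσ]
        have hen := D.support_subset k h ((PMF.mem_support_iff _ _).2 hσ)
        rw [lintegral_stepLaw_nextPotential hX k m hen, potential, h.extend_state]
        gcongr
        split_ifs
        · exact le_rfl
        · exact le_iSup₂_of_le σ hen le_rfl
    _ = M.potential G X k (m + 1) h.extend := by rw [← Finset.sum_mul, sum_choice, one_mul]

/-- Martingale step: equality holds when the policy puts all its mass on a maximizing label. -/
theorem lintegral_nextPotential_eq (D : M.Policy) {X : Set ℝ} (hX : X.OrdConnected) (k m : ℕ)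
    (h : FinPath S A k) {τ : Label A} (hτ : τ ∈ M.enabled h.last) (hD : D.choice k h = PMF.pure τ)
    (hmax : M.stageValue G X (M.stepValue G X m) h.last (h.extend.entryTime k) τ =
      M.stepValue G X (m + 1) h.last (h.extend.entryTime k)) :
    ∫⁻ y, M.nextPotential G X k m h y ∂D.kernel k h = M.potential G X k (m + 1) h.extend := by
  rw [lintegral_nextLaw, hD, Finset.sum_eq_single τ (fun σ _ hσ => by simp [hσ]) (by simp),
    PMF.pure_apply_self, one_mul, lintegral_stepLaw_nextPotential hX k m hτ, potential,
    h.extend_state, hmax]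

theorem lintegral_potential_succ (D : M.Policy) (s : S) {X : Set ℝ} (hX : X.OrdConnected)
    (k m : ℕ) :
    ∫⁻ π, M.potential G X (k + 1) m π ∂D.pathMeasure s =
      ∫⁻ π, ∫⁻ y, M.nextPotential G X k m (Preorder.frestrictLe k π) y
        ∂D.kernel k (Preorder.frestrictLe k π) ∂D.pathMeasure s := by
  simp only [potential_succ]
  exact lintegral_pathMeasure_pair D s k (measurable_nextPotential hX k m)

theorem lintegral_potential_zero (D : M.Policy) (s : S) {X : Set ℝ} (m : ℕ) :
    ∫⁻ π, M.potential G X 0 m π ∂D.pathMeasure s = M.stepValue G X m s 0 := by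
  have hp (π : TimedPath S A) : M.potential G X 0 m π = M.stepValue G X m
      (FinPath.last (Preorder.frestrictLe 0 π : FinPath S A 0)) 0 := by
    have : ¬ π.HitsWithin G X 0 := by
      rintro ⟨i, hi, -⟩
      exact i.not_lt_zero hi
    rw [potential, if_neg this, TimedPath.entryTime, Finset.sum_range_zero]
    rfl
  have hm : Measurable fun h : FinPath S A 0 => M.stepValue G X m h.last 0 :=
    (Measurable.of_discrete (f := fun s => M.stepValue G X m s 0)).comp measurable_last
  simp only [hp]
  rw [← lintegral_map hm (Preorder.measurable_frestrictLe 0), Policy.pathMeasure,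
    Kernel.traj_map_frestrictLe_apply, Kernel.partialTraj_self, Kernel.id_apply,
    lintegral_dirac' _ hm]
  rfl

theorem lintegral_potential_last (D : M.Policy) (s : S) {X : Set ℝ} (hX : X.OrdConnected) (n : ℕ) :
    ∫⁻ π, M.potential G X n 0 π ∂D.pathMeasure s = D.pathMeasure s {π | π.HitsWithin G X n} := by
  rw [← lintegral_indicator_one (TimedPath.measurableSet_hitsWithin G hX n)]
  refine lintegral_congr fun π => ?_
  by_cases h : π.HitsWithin G X n <;> simp [potential, h, stepValue]

/-! ### Optimality over a finite horizon, and the limit. -/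

theorem pathMeasure_hitsWithin_le (D : M.Policy) (s : S) {X : Set ℝ} (hX : X.OrdConnected)
    (n : ℕ) : D.pathMeasure s {π | π.HitsWithin G X n} ≤ M.stepValue G X n s 0 := by
  have key (k : ℕ) : ∀ m, ∫⁻ π, M.potential G X k m π ∂D.pathMeasure s ≤
      M.stepValue G X (k + m) s 0 := by
    induction k with
    | zero => exact fun m => by rw [lintegral_potential_zero, zero_add]
    | succ k ih =>
      intro m
      rw [lintegral_potential_succ D s hX, Nat.add_right_comm, Nat.add_assoc]
      refine (lintegral_mono fun π => ?_).trans (ih (m + 1))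
      rw [← potential_frestrictLe]
      exact lintegral_nextPotential_le D hX k m _
  rw [← lintegral_potential_last D s hX]
  exact key n 0

/-- Some policy attains the optimal probability of a hit within `n` stages. -/
theorem exists_policy_eq_stepValue {X : Set ℝ} (hX : X.OrdConnected) (n : ℕ) :
    ∃ D : M.Policy, ∀ s,
      D.pathMeasure s {π | π.HitsWithin G X n} = M.stepValue G X n s 0 := by
  have hsel (m : ℕ) (s : S) := exists_measurable_argmax
    (f := fun σ t => M.stageValue G X (M.stepValue G X m) s t σ)
    (measurable_stageValue hX (measurable_stepValue hX m) s)
    (toFinite (M.enabled s)) (M.enabled_nonempty s)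
  choose g hg hgE using hsel
  -- After this choice `n - (k + 1)` stages remain. For `k ≥ n` the subtraction truncates to `0`,
  -- harmlessly: those choices do not affect a hit within `n` stages.
  let τ (k : ℕ) (h : FinPath S A k) : Label A := g (n - (k + 1)) h.last (h.extend.entryTime k)
  have hτ (k : ℕ) : Measurable (τ k) :=
    (measurable_uncurry_of_finite (hg (n - (k + 1)))).comp
      (measurable_last.prodMk ((TimedPath.measurable_entryTime k).comp FinPath.measurable_extend))
  let D : M.Policy :=
    { choice := fun k h => PMF.pure (τ k h)
      measurable_choice := fun k σ =>
        (Measurable.of_discrete (f := fun l : Label A => PMF.pure l σ)).comp (hτ k)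
      support_subset := fun k h => by
        rw [PMF.support_pure, singleton_subset_iff]
        exact (hgE _ _ _).1 }
  refine ⟨D, fun s => ?_⟩
  have key (k : ℕ) : ∀ m, k + m = n → ∫⁻ π, M.potential G X k m π ∂D.pathMeasure s =
      M.stepValue G X n s 0 := by
    induction k with
    | zero =>
      rintro m rfl
      rw [lintegral_potential_zero, zero_add]
    | succ k ih =>
      intro m hm
      rw [lintegral_potential_succ D s hX, ← ih (m + 1) (by omega)]
      refine lintegral_congr fun π => ?_
      rw [← potential_frestrictLe]
      have hk : n - (k + 1) = m := by omega
      refine lintegral_nextPotential_eq D hX k m _ (hgE (n - (k + 1)) _ _).1 rfl ?_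
      rw [hk]
      exact (hgE m _ _).2
  rw [← lintegral_potential_last D s hX]
  exact key n 0 rfl

/-- The optimal policy depends on the horizon, but both limits are suprema and may be exchanged. -/
theorem pMax_eq_iSup_stepValue :
    M.pMax G = fun s I => ⨆ n, M.stepValue G I.carrier n s 0 := by
  funext s I
  have hmono : Monotone fun n => {π : TimedPath S A | π.HitsWithin G I.carrier n} :=
    fun m n h π ⟨i, hi, hπ⟩ => ⟨i, hi.trans_le h, hπ⟩
  simp only [pMax, TimedPath.reach_eq_iUnion, hmono.measure_iUnion]
  rw [iSup_comm]
  refine iSup_congr fun n => le_antisymm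
    (iSup_le fun D => pathMeasure_hitsWithin_le D s I.ordConnected n) ?_
  obtain ⟨D, hD⟩ := exists_policy_eq_stepValue (M := M) (G := G) I.ordConnected n
  exact le_iSup_of_le D (hD s).ge

end MarkovAutomaton

end

theorem lemma1 {S A : Type*} [Fintype S] [Fintype A] [MeasurableSpace S]
    [DiscreteMeasurableSpace S] (M : MarkovAutomaton S A) (G : Set S) :
    -- `Ω` maps `[0,1]`-valued functions to `[0,1]`-valued functions
    (∀ F : S → TimeInterval → ℝ≥0∞, (∀ s I, F s I ≤ 1) → ∀ s I, M.Omega G F s I ≤ 1) ∧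
    -- the integrands in `Ω (p_max)` are measurable
    (∀ (s : S) (I : TimeInterval),
      Measurable fun t : ℝ => TimeInterval.evalShift (M.pMax G s) I t) ∧
    -- `p_max` is the least fixed point of `Ω` among the `[0,1]`-valued functions
    IsLeast {F : S → TimeInterval → ℝ≥0∞ | (∀ s I, F s I ≤ 1) ∧ M.Omega G F = F}
      (M.pMax G) := by
  rw [MarkovAutomaton.pMax_eq_iSup_stepValue]
  exact ⟨fun F hF => M.Omega_le_one G hF,
    MarkovAutomaton.measurable_evalShift_iSup_stepValue, MarkovAutomaton.isLeast_iSup_stepValue⟩
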